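/- Let $U$ and $V$ be finite-dimensional real inner product spaces of dimensions $m$ and $n$, and let $J\colon U\to\operatorname{End}(V)$, $z\mapsto J_z$, be a linear map such that $|J_z v|=|z|\,|v|$ and $J_z(J_z v)=-|z|^2 v$ for all $z\in U$, $v\in V$. Let $N=U\oplus V$ (orthogonal direct sum) be the associated H-type Lie algebra: $U$ is contained in the center, and the bracket of two elements $v,w\in V$ is the element $[v,w]\in U$ determined by $(z,[v,w])=(J_z v,w)$ for all $z\in U$. Then there exist orthonormal bases $z_1,\dots,z_m$ of $U$ and $v_1,\dots,v_n$ of $V$ such that the numbers $A^k_{ij}$ defined by $[v_i,v_j]=\sum_{k=1}^m A^k_{ij}z_k$ are integers, each equal to $0$, $1$ or $-1$. In particular, all structure constants of $N$ with respect to the basis $z_1,\dots,z_m,v_1,\dots,v_n$ are $0$, $1$ or $-1$. -/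

import Mathlib

open scoped InnerProductSpace

noncomputable section

/-- An orthogonal multiplication `J : U → End V`, `z ↦ J_z`: a linear map with
`|J_z v| = |z| |v|` and `J_z (J_z v) = -|z|² v`. -/
structure OrthogonalMultiplication (U : Type*) (V : Type*)
    [NormedAddCommGroup U] [InnerProductSpace ℝ U]
    [NormedAddCommGroup V] [InnerProductSpace ℝ V] where
  /-- The linear map `z ↦ J_z`. -/
  J : U →ₗ[ℝ] Module.End ℝ V
  norm_J : ∀ (z : U) (v : V), ‖J z v‖ = ‖z‖ * ‖v‖
  J_J : ∀ (z : U) (v : V), J z (J z v) = -(‖z‖ ^ 2 • v)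

namespace OrthogonalMultiplication

variable {U V : Type*} [NormedAddCommGroup U] [InnerProductSpace ℝ U]
  [NormedAddCommGroup V] [InnerProductSpace ℝ V]

theorem inner_J_self (M : OrthogonalMultiplication U V) (z : U) (v : V) :
    ⟪M.J z v, v⟫_ℝ = 0 := by
  by_cases hz : z = 0
  · simp [hz]
  have hpos : 0 < ‖z‖ ^ 2 := by positivity
  have h1 := M.norm_J z (v + M.J z v)
  rw [map_add, M.J_J, ← sub_eq_add_neg] at h1
  have h2 := congrArg (fun t : ℝ => t ^ 2) h1
  simp only [mul_pow, norm_sub_sq_real, norm_add_sq_real, inner_smul_right, norm_smul,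
    norm_pow, norm_norm, M.norm_J, real_inner_comm (M.J z v) v] at h2
  have h3 : ‖z‖ ^ 2 * ⟪M.J z v, v⟫_ℝ = 0 := by
    nlinarith [h2]
  exact (mul_eq_zero.mp h3).resolve_left hpos.ne'

variable [FiniteDimensional ℝ U] [FiniteDimensional ℝ V]

/-- The `U`-valued bracket of two elements of `V`: the adjoint of `z ↦ J_z v₁`, applied to `v₂`.
Equivalently, the unique element of `U` with `(z, [v₁, v₂]) = (J_z v₁, v₂)` for all `z`. -/
def bracketV (M : OrthogonalMultiplication U V) (v₁ v₂ : V) : U :=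
  LinearMap.adjoint (M.J.flip v₁) v₂

/-- The defining property of the bracket. -/
theorem inner_bracketV (M : OrthogonalMultiplication U V) (z : U) (v₁ v₂ : V) :
    ⟪z, M.bracketV v₁ v₂⟫_ℝ = ⟪M.J z v₁, v₂⟫_ℝ := by
  simp [bracketV, LinearMap.adjoint_inner_right]

theorem bracketV_add_left (M : OrthogonalMultiplication U V) (a b c : V) :
    M.bracketV (a + b) c = M.bracketV a c + M.bracketV b c := by
  simp [bracketV]

theorem bracketV_add_right (M : OrthogonalMultiplication U V) (a b c : V) :
    M.bracketV a (b + c) = M.bracketV a b + M.bracketV a c := by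
  simp [bracketV]

theorem bracketV_smul_right (M : OrthogonalMultiplication U V) (t : ℝ) (a b : V) :
    M.bracketV a (t • b) = t • M.bracketV a b := by
  simp [bracketV]

theorem bracketV_zero_right (M : OrthogonalMultiplication U V) (a : V) :
    M.bracketV a 0 = 0 := by
  simp [bracketV]

theorem bracketV_zero_left (M : OrthogonalMultiplication U V) (a : V) :
    M.bracketV 0 a = 0 := by
  simp [bracketV]

theorem bracketV_self (M : OrthogonalMultiplication U V) (a : V) :
    M.bracketV a a = 0 := by
  refine ext_inner_left ℝ fun z => ?_
  rw [M.inner_bracketV, M.inner_J_self, inner_zero_right]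

end OrthogonalMultiplication

/-- The H-type Lie algebra `N = U ⊕ V` of an orthogonal multiplication; as an inner product
space it is the orthogonal direct sum of `U` and `V`. -/
def HTypeLieAlgebra {U V : Type*} [NormedAddCommGroup U] [InnerProductSpace ℝ U]
    [NormedAddCommGroup V] [InnerProductSpace ℝ V]
    (_M : OrthogonalMultiplication U V) : Type _ :=
  WithLp 2 (U × V)

namespace HTypeLieAlgebra

variable {U V : Type*} [NormedAddCommGroup U] [InnerProductSpace ℝ U]
  [NormedAddCommGroup V] [InnerProductSpace ℝ V]

instance (M : OrthogonalMultiplication U V) : NormedAddCommGroup (HTypeLieAlgebra M) :=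
  inferInstanceAs (NormedAddCommGroup (WithLp 2 (U × V)))

instance (M : OrthogonalMultiplication U V) : InnerProductSpace ℝ (HTypeLieAlgebra M) :=
  inferInstanceAs (InnerProductSpace ℝ (WithLp 2 (U × V)))

/-- The element `z + v` of `N = U ⊕ V`. -/
def mk (M : OrthogonalMultiplication U V) (z : U) (v : V) : HTypeLieAlgebra M :=
  WithLp.toLp 2 (z, v)

/-- The inclusion of `U` in `N`. -/
def ofU (M : OrthogonalMultiplication U V) (z : U) : HTypeLieAlgebra M := mk M z 0

/-- The inclusion of `V` in `N`. -/
def ofV (M : OrthogonalMultiplication U V) (v : V) : HTypeLieAlgebra M := mk M 0 v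

/-- The `U`-component. -/
def toU {M : OrthogonalMultiplication U V} (x : HTypeLieAlgebra M) : U :=
  (WithLp.ofLp (p := 2) (V := U × V) x).1

/-- The `V`-component. -/
def toV {M : OrthogonalMultiplication U V} (x : HTypeLieAlgebra M) : V :=
  (WithLp.ofLp (p := 2) (V := U × V) x).2

/-- The orthonormal basis `z₁, …, z_m, v₁, …, v_n` of `N` given by orthonormal bases
of `U` and of `V`. -/
def basis (M : OrthogonalMultiplication U V) {ι κ : Type*} [Fintype ι] [Fintype κ]
    (z : OrthonormalBasis ι ℝ U) (v : OrthonormalBasis κ ℝ V) :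
    OrthonormalBasis (ι ⊕ κ) ℝ (HTypeLieAlgebra M) :=
  OrthonormalBasis.prod z v

theorem basis_inl (M : OrthogonalMultiplication U V) {ι κ : Type*} [Fintype ι] [Fintype κ]
    (z : OrthonormalBasis ι ℝ U) (v : OrthonormalBasis κ ℝ V) (i : ι) :
    basis M z v (Sum.inl i) = ofU M (z i) :=
  (OrthonormalBasis.prod_apply z v (Sum.inl i)).trans rfl

theorem basis_inr (M : OrthogonalMultiplication U V) {ι κ : Type*} [Fintype ι] [Fintype κ]
    (z : OrthonormalBasis ι ℝ U) (v : OrthonormalBasis κ ℝ V) (j : κ) :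
    basis M z v (Sum.inr j) = ofV M (v j) :=
  (OrthonormalBasis.prod_apply z v (Sum.inr j)).trans rfl

variable [FiniteDimensional ℝ U] [FiniteDimensional ℝ V]

/-- The bracket of `N`: `U` is central, and the bracket of elements of `V` lies in `U`. -/
instance (M : OrthogonalMultiplication U V) : LieRing (HTypeLieAlgebra M) where
  bracket x y := ofU M (M.bracketV x.toV y.toV)
  add_lie x y w := by
    have h := M.bracketV_add_left x.toV y.toV w.toV
    change ofU M (M.bracketV (x.toV + y.toV) w.toV) = mk M (_ + _) (0 + 0)
    rw [h, add_zero]; rfl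
  lie_add x y w := by
    have h := M.bracketV_add_right x.toV y.toV w.toV
    change ofU M (M.bracketV x.toV (y.toV + w.toV)) = mk M (_ + _) (0 + 0)
    rw [h, add_zero]; rfl
  lie_self x := by
    change ofU M (M.bracketV x.toV x.toV) = mk M 0 0
    rw [M.bracketV_self]; rfl
  leibniz_lie x y w := by
    change ofU M (M.bracketV x.toV 0)
      = mk M (M.bracketV 0 w.toV + M.bracketV y.toV 0) (0 + 0)
    simp only [M.bracketV_zero_left, M.bracketV_zero_right, add_zero]; rfl

instance (M : OrthogonalMultiplication U V) : LieAlgebra ℝ (HTypeLieAlgebra M) where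
  lie_smul t x y := by
    have h := M.bracketV_smul_right t x.toV y.toV
    change ofU M (M.bracketV x.toV (t • y.toV)) = mk M (t • _) (t • 0)
    rw [h, smul_zero]; rfl

theorem lie_mk_mk (M : OrthogonalMultiplication U V) (z₁ z₂ : U) (v₁ v₂ : V) :
    ⁅mk M z₁ v₁, mk M z₂ v₂⁆ = ofU M (M.bracketV v₁ v₂) := rfl

/-- The structure constants of `N` with respect to the basis `z₁, …, z_m, v₁, …, v_n`:
the `r`-th coordinate of the bracket of the `p`-th and the `q`-th basis vector. -/
def structureConstant (M : OrthogonalMultiplication U V) {ι κ : Type*} [Fintype ι] [Fintype κ]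
    (z : OrthonormalBasis ι ℝ U) (v : OrthonormalBasis κ ℝ V) (p q r : ι ⊕ κ) : ℝ :=
  (basis M z v).repr ⁅basis M z v p, basis M z v q⁆ r

end HTypeLieAlgebra

end

/-! The structure constants are the matrix entries of the maps `J (z k)`, so a basis of `V` is
needed in which all these are 0, 1 or -1. For orthonormal `z k` the maps generate a monoid `G` of
isometries that square to ±1 and commute up to sign. The key is a unit vector `v` for which each `g
v` is `v`, `-v` or orthogonal to `v` (`exists_inner_eq_zero_or`). Its orbit then consists of vectors
pairwise equal, opposite or orthogonal. Orthogonal complements of `G`-stable sets are `G`-stable, so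
such orbits accumulate until they span `V`; a basis chosen among their vectors works for every `g`
at once. -/

open scoped InnerProductSpace

/-! ### Signed orbits of sign-commuting isometries -/

section SignedOrbit

variable {V : Type*} [NormedAddCommGroup V] [InnerProductSpace ℝ V]

/-- A monoid of linear isometries which square to `±1` and pairwise commute or anticommute. -/
structure IsSignCommuting (G : Submonoid (Module.End ℝ V)) : Prop where
  norm_apply : ∀ g ∈ G, ∀ v, ‖g v‖ = ‖v‖
  mul_self : ∀ g ∈ G, g * g = 1 ∨ g * g = -1
  comm : ∀ g ∈ G, ∀ h ∈ G, g * h = h * g ∨ g * h = -(h * g)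

/-- Reordering factors costs only a sign, so `(x * y) ^ 2` is `x ^ 2 * y ^ 2` up to sign. -/
theorem IsSignCommuting.closure {s : Set (Module.End ℝ V)}
    (hn : ∀ g ∈ s, ∀ v, ‖g v‖ = ‖v‖) (hs : ∀ g ∈ s, g * g = -1)
    (hc : ∀ g ∈ s, ∀ h ∈ s, g * h = h * g ∨ g * h = -(h * g)) :
    IsSignCommuting (Submonoid.closure s) := by
  have comm : ∀ g ∈ Submonoid.closure s, ∀ h ∈ Submonoid.closure s,
      g * h = h * g ∨ g * h = -(h * g) := by
    intro g hg h hh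
    induction hg, hh using Submonoid.closure_induction₂ with
    | mem x y hx hy => exact hc x hx y hy
    | one_left x hx => simp
    | one_right x hx => simp
    | mul_left x y z _ _ _ h₁ h₂ =>
      rw [mul_assoc, ← mul_assoc z x y]
      rcases h₁ with h₁ | h₁ <;> rcases h₂ with h₂ | h₂ <;> rw [h₂] <;>
        simp [← mul_assoc, h₁]
    | mul_right x y z _ _ _ h₁ h₂ =>
      rw [← mul_assoc, mul_assoc x y z]
      rcases h₁ with h₁ | h₁ <;> rcases h₂ with h₂ | h₂ <;> rw [h₁] <;>
        simp [mul_assoc, h₂]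
  refine ⟨fun g hg => ?_, fun g hg => ?_, comm⟩
  · induction hg using Submonoid.closure_induction with
    | mem x hx => exact hn x hx
    | one => simp
    | mul x y _ _ hx hy => intro v; rw [Module.End.mul_apply, hx, hy]
  · induction hg using Submonoid.closure_induction with
    | mem x hx => exact Or.inr (hs x hx)
    | one => simp
    | mul x y hx' hy' hx hy =>
      have e : x * y * (x * y) = x * (y * x) * y := by simp only [mul_assoc]
      have e' : x * (x * y) * y = (x * x) * (y * y) := by simp only [mul_assoc]
      rw [e]
      rcases comm y hy' x hx' with h | h <;> rcases hx with hx | hx <;>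
        rcases hy with hy | hy <;> simp [h, e', hx, hy]

namespace IsSignCommuting

variable {G : Submonoid (Module.End ℝ V)}

theorem inner_apply_apply (hG : IsSignCommuting G) {g : Module.End ℝ V} (hg : g ∈ G) (v w : V) :
    ⟪g v, g w⟫_ℝ = ⟪v, w⟫_ℝ :=
  LinearIsometry.inner_map_map ⟨g, hG.norm_apply g hg⟩ v w

/-- The inverse of `g`, hence its adjoint, is `g` or `-g`. -/
theorem inner_apply_right (hG : IsSignCommuting G) {g : Module.End ℝ V} (hg : g ∈ G) (v w : V) :
    ⟪v, g w⟫_ℝ = ⟪g v, w⟫_ℝ ∨ ⟪v, g w⟫_ℝ = -⟪g v, w⟫_ℝ := by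
  rw [← hG.inner_apply_apply hg v (g w), ← Module.End.mul_apply]
  rcases hG.mul_self g hg with h | h <;> simp [h]

/-- The vectors which are eigenvectors, with the same eigenvalue, of every element of `G` of which
`v` is an eigenvector. -/
def jointEigenspace (G : Submonoid (Module.End ℝ V)) (v : V) : Submodule ℝ V where
  carrier := {x | ∀ g ∈ G, ∀ c : ℝ, g v = c • v → g x = c • x}
  add_mem' hx hy g hg c h := by rw [map_add, hx g hg c h, hy g hg c h, smul_add]
  zero_mem' g _ c _ := by simp
  smul_mem' t x hx g hg c h := by rw [map_smul, hx g hg c h, smul_comm]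

variable [FiniteDimensional ℝ V]

/-- Minimizing the dimension of the joint eigenspace makes `v` an eigenvector of as much of `G` as
possible. If `⟪g v, v⟫ ≠ 0`, the projection `v + g v` retains all eigenvalue relations of `v`, so by
minimality it gains none. -/
theorem exists_inner_eq_zero_or (hG : IsSignCommuting G) {W : Submodule ℝ V} (hW : W ≠ ⊥)
    (hGW : ∀ g ∈ G, ∀ w ∈ W, g w ∈ W) :
    ∃ v ∈ W, v ≠ 0 ∧ ∀ g ∈ G, ⟪g v, v⟫_ℝ = 0 ∨ g v = v ∨ g v = -v := by
  obtain ⟨v₀, hv₀, hv₀'⟩ := W.ne_bot_iff.1 hW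
  obtain ⟨v, ⟨hvW, hv⟩, hmin⟩ := (measure fun v : V =>
    Module.finrank ℝ (jointEigenspace G v)).wf.has_min {v | v ∈ W ∧ v ≠ 0} ⟨v₀, hv₀, hv₀'⟩
  refine ⟨v, hvW, hv, fun g hg => or_iff_not_imp_left.2 fun hne => ?_⟩
  -- An isometry with square -1 is skew, which would give `⟪g v, v⟫ = 0`.
  have hgg : g * g = 1 := by
    refine (hG.mul_self g hg).resolve_right fun h => hne ?_
    have h₁ := hG.inner_apply_apply hg (g v) v
    rw [← Module.End.mul_apply, h, real_inner_comm] at h₁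
    simp only [LinearMap.neg_apply, Module.End.one_apply, inner_neg_right] at h₁
    linarith
  -- If `h` anticommutes with `g`, then `h (g v) = -c • g v`; as `h` is an isometry, `⟪g v, v⟫ = -c
  -- ^ 2 * ⟪g v, v⟫`.
  have hcomm : ∀ h ∈ G, ∀ c : ℝ, h v = c • v → g * h = h * g := by
    refine fun h hh c hc => (hG.comm g hg h hh).resolve_right fun hac => hne ?_
    have h₁ := hG.inner_apply_apply hh (g v) v
    have h₂ : h (g v) = -(c • g v) := by
      have := congrArg (fun f => f v) hac
      simp only [Module.End.mul_apply, LinearMap.neg_apply, hc, map_smul] at this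
      rw [this, neg_neg]
    rw [h₂, hc, inner_neg_left, real_inner_smul_left, real_inner_smul_right] at h₁
    have h₃ : (1 + c ^ 2) * ⟪g v, v⟫_ℝ = 0 := by linear_combination -h₁
    exact (mul_eq_zero.1 h₃).resolve_left (by positivity)
  by_cases hw : v + g v = 0
  · exact Or.inr (eq_neg_of_add_eq_zero_right hw)
  left
  have hle : jointEigenspace G (v + g v) ≤ jointEigenspace G v := by
    intro x hx h hh c hc
    refine hx h hh c ?_
    rw [map_add, ← Module.End.mul_apply, ← hcomm h hh c hc, Module.End.mul_apply, hc, map_smul,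
      smul_add]
  have heq := Submodule.eq_of_le_of_finrank_le hle
    (not_lt.1 (hmin (v + g v) ⟨W.add_mem hvW (hGW g hg v hvW), hw⟩))
  have hmem : v ∈ jointEigenspace G (v + g v) := by
    rw [heq]; exact fun _ _ _ h => h
  -- `g` fixes `v + g v`, so it also fixes `v`.
  have := hmem g hg 1 (by
    rw [map_add, ← Module.End.mul_apply, hgg, one_smul, Module.End.one_apply, add_comm])
  simpa using this

/-- There is a spanning set, stable under `G`, of unit vectors which are pairwise equal,
opposite or orthogonal. -/
theorem exists_span_eq_top (hG : IsSignCommuting G) :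
    ∃ s : Set V, (∀ x ∈ s, ‖x‖ = 1) ∧ (∀ x ∈ s, ∀ y ∈ s, ⟪x, y⟫_ℝ = 0 ∨ x = y ∨ x = -y) ∧
      (∀ g ∈ G, ∀ x ∈ s, g x ∈ s) ∧ Submodule.span ℝ s = ⊤ := by
  obtain ⟨s, hs⟩ := zorn_subset {s : Set V | (∀ x ∈ s, ‖x‖ = 1) ∧
      (∀ x ∈ s, ∀ y ∈ s, ⟪x, y⟫_ℝ = 0 ∨ x = y ∨ x = -y) ∧ ∀ g ∈ G, ∀ x ∈ s, g x ∈ s} (by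
    refine fun c hc hchain => ⟨⋃₀ c, ⟨?_, ?_, ?_⟩, fun t ht => Set.subset_sUnion_of_mem ht⟩
    · rintro x ⟨t, ht, hx⟩
      exact (hc ht).1 x hx
    · rintro x ⟨t, ht, hx⟩ y ⟨u, hu, hy⟩
      rcases hchain.total ht hu with h | h
      · exact (hc hu).2.1 x (h hx) y hy
      · exact (hc ht).2.1 x hx y (h hy)
    · rintro g hg x ⟨t, ht, hx⟩
      exact ⟨t, ht, (hc ht).2.2 g hg x hx⟩)
  obtain ⟨h₁, h₂, h₃⟩ := hs.prop
  refine ⟨s, h₁, h₂, h₃, by_contra fun hspan => ?_⟩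
  have hW : (Submodule.span ℝ s)ᗮ ≠ ⊥ := fun h =>
    hspan ((Submodule.orthogonal_eq_bot_iff).1 h)
  have hGW : ∀ g ∈ G, ∀ w ∈ (Submodule.span ℝ s)ᗮ, g w ∈ (Submodule.span ℝ s)ᗮ := by
    intro g hg w hw
    rw [← Submodule.span_singleton_le_iff_mem, ← Submodule.isOrtho_iff_le,
      Submodule.isOrtho_comm, Submodule.isOrtho_span]
    rintro x hx _ rfl
    have h₀ : ⟪g x, w⟫_ℝ = 0 := hw _ (Submodule.subset_span (h₃ g hg x hx))
    rcases hG.inner_apply_right hg x w with h | h <;> simp [h, h₀]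
  obtain ⟨v₀, hv₀, hne, hv₀'⟩ := hG.exists_inner_eq_zero_or hW hGW
  obtain ⟨v, hv, hnorm, hv'⟩ : ∃ v ∈ (Submodule.span ℝ s)ᗮ, ‖v‖ = 1 ∧
      ∀ g ∈ G, ⟪g v, v⟫_ℝ = 0 ∨ g v = v ∨ g v = -v := by
    refine ⟨‖v₀‖⁻¹ • v₀, Submodule.smul_mem _ _ hv₀, by
      rw [norm_smul, norm_inv, norm_norm, inv_mul_cancel₀ (norm_ne_zero_iff.2 hne)],
      fun g hg => ?_⟩
    rcases hv₀' g hg with h | h | h <;> simp [h, real_inner_smul_left, real_inner_smul_right]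
  have horth : ∀ x ∈ s, ∀ g ∈ G, ⟪x, g v⟫_ℝ = 0 := fun x hx g hg =>
    hGW g hg v hv x (Submodule.subset_span hx)
  have hmem : v ∈ s := by
    refine hs.le_of_ge (y := s ∪ {x | ∃ g ∈ G, g v = x}) ⟨?_, ?_, ?_⟩
      Set.subset_union_left (Or.inr ⟨1, G.one_mem, rfl⟩)
    · rintro x (hx | ⟨g, hg, rfl⟩)
      · exact h₁ x hx
      · rw [hG.norm_apply g hg, hnorm]
    · rintro x (hx | ⟨g, hg, rfl⟩) y (hy | ⟨h, hh, rfl⟩)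
      · exact h₂ x hx y hy
      · exact Or.inl (horth x hx h hh)
      · exact Or.inl (by rw [real_inner_comm]; exact horth y hy g hg)
      · have hinj : Function.Injective h :=
          LinearIsometry.injective ⟨h, hG.norm_apply h hh⟩
        -- Applying `h` to both vectors turns the pair `g v`, `h v` into `h (g v)`, `±v`, which the
        -- choice of `v` controls.
        have key := hv' (h * g) (G.mul_mem hh hg)
        rw [Module.End.mul_apply] at key
        have e : h (h v) = v ∨ h (h v) = -v := by
          rw [← Module.End.mul_apply]
          rcases hG.mul_self h hh with h' | h' <;> simp [h']
        rw [← hG.inner_apply_apply hh, ← hinj.eq_iff, ← hinj.eq_iff (b := -h v), map_neg]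
        rcases e with e | e <;> rw [e]
        · exact key
        · rwa [inner_neg_right, neg_eq_zero, neg_neg, or_comm (a := h (g v) = -v)]
    · rintro g hg x (hx | ⟨h, hh, rfl⟩)
      · exact Or.inl (h₃ g hg x hx)
      · exact Or.inr ⟨g * h, G.mul_mem hg hh, rfl⟩
  -- By maximality `v` lies in `s`, yet it is orthogonal to `s`.
  have h0 : ⟪v, v⟫_ℝ = 0 := horth v hmem 1 G.one_mem
  rw [real_inner_self_eq_norm_sq, hnorm] at h0
  norm_num at h0

/-- Linear independence excludes opposite vectors, so a basis drawn from `s` is orthonormal, and `g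
(b i)` is again in `s`. -/
theorem exists_orthonormalBasis (hG : IsSignCommuting G) :
    ∃ b : OrthonormalBasis (Fin (Module.finrank ℝ V)) ℝ V, ∀ g ∈ G, ∀ i j,
      ⟪g (b i), b j⟫_ℝ = 0 ∨ ⟪g (b i), b j⟫_ℝ = 1 ∨ ⟪g (b i), b j⟫_ℝ = -1 := by
  obtain ⟨s, hnorm, horth, hGs, hspan⟩ := hG.exists_span_eq_top
  obtain ⟨t, hts, htspan, hli⟩ := exists_linearIndependent ℝ s
  have hon : Orthonormal ℝ ((↑) : t → V) := by
    refine ⟨fun x => hnorm x (hts x.2), fun x y hxy => ?_⟩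
    rcases horth x (hts x.2) y (hts y.2) with h | h | h
    · exact h
    · exact absurd (Subtype.ext h) hxy
    · refine absurd ?_ (hli.notMem_span_image (s := {y}) (x := x) hxy)
      rw [Set.image_singleton, h]
      exact Submodule.neg_mem _ (Submodule.mem_span_singleton_self _)
  have : Fintype t := @Fintype.ofFinite _ hli.finite
  let b := (OrthonormalBasis.mk hon (by simp [htspan, hspan])).reindex
    (Fintype.equivFinOfCardEq (by
      rw [← finrank_span_eq_card hli, Subtype.range_coe, htspan, hspan, finrank_top]))
  have hb : ∀ i, b i ∈ s := fun i => by
    simp only [b, OrthonormalBasis.reindex_apply, OrthonormalBasis.coe_mk]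
    exact hts (Subtype.coe_prop _)
  refine ⟨b, fun g hg i j => ?_⟩
  rcases horth _ (hGs g hg _ (hb i)) _ (hb j) with h | h | h
  · exact Or.inl h
  · simp [h]
  · simp [h]

end IsSignCommuting

end SignedOrbit

/-! ### Clifford relations and structure constants -/

namespace OrthogonalMultiplication

variable {U V : Type*} [NormedAddCommGroup U] [InnerProductSpace ℝ U]
  [NormedAddCommGroup V] [InnerProductSpace ℝ V]

/-- Polarization of `J z * J z = -‖z‖ ^ 2`. -/
theorem J_mul_J_add (M : OrthogonalMultiplication U V) {z w : U} (h : ⟪z, w⟫_ℝ = 0) :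
    M.J z * M.J w = -(M.J w * M.J z) := by
  ext v
  have h₁ := M.J_J (z + w) v
  rw [norm_add_sq_real, h] at h₁
  simp only [map_add, LinearMap.add_apply, M.J_J, mul_zero, add_zero, add_smul] at h₁
  simp only [Module.End.mul_apply, LinearMap.neg_apply]
  rw [← sub_eq_zero] at h₁ ⊢
  rw [← h₁]
  abel

theorem isSignCommuting_closure_range (M : OrthogonalMultiplication U V) {ι : Type*} {z : ι → U}
    (hz : Orthonormal ℝ z) :
    IsSignCommuting (Submonoid.closure (Set.range fun k => M.J (z k))) := by
  refine .closure ?_ ?_ ?_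
  · rintro _ ⟨k, rfl⟩ v
    simp [M.norm_J, hz.1 k]
  · rintro _ ⟨k, rfl⟩
    ext v
    simp [M.J_J, hz.1 k]
  · rintro _ ⟨k, rfl⟩ _ ⟨l, rfl⟩
    by_cases hkl : k = l
    · exact Or.inl (by rw [hkl])
    · exact Or.inr (M.J_mul_J_add (hz.2 hkl))

end OrthogonalMultiplication

namespace HTypeLieAlgebra

variable {U V : Type*} [NormedAddCommGroup U] [InnerProductSpace ℝ U]
  [NormedAddCommGroup V] [InnerProductSpace ℝ V] (M : OrthogonalMultiplication U V)

/-- The inclusion of `U` in `N`, as a linear map. -/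
def ofULinear : U →ₗ[ℝ] HTypeLieAlgebra M where
  toFun := ofU M
  map_add' z w := by
    change mk M (z + w) 0 = mk M (z + w) (0 + 0)
    rw [add_zero]
  map_smul' c z := by
    change mk M (c • z) 0 = mk M (c • z) (c • 0)
    rw [smul_zero]

variable [FiniteDimensional ℝ U] [FiniteDimensional ℝ V]

theorem lie_ofV_ofV_eq_sum {ι : Type*} [Fintype ι] (z : OrthonormalBasis ι ℝ U) (v w : V) :
    ⁅ofV M v, ofV M w⁆ = ∑ k, ⟪M.J (z k) v, w⟫_ℝ • ofU M (z k) := by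
  have h : ⁅ofV M v, ofV M w⁆ = ofULinear M (M.bracketV v w) := rfl
  rw [h, ← z.sum_repr' (M.bracketV v w), map_sum]
  refine Finset.sum_congr rfl fun k _ => ?_
  rw [map_smul, M.inner_bracketV]
  rfl

theorem lie_ofU_left (z : U) (x : HTypeLieAlgebra M) : ⁅ofU M z, x⁆ = 0 := by
  change ofU M (M.bracketV 0 x.toV) = 0
  rw [M.bracketV_zero_left]
  rfl

theorem lie_ofU_right (x : HTypeLieAlgebra M) (z : U) : ⁅x, ofU M z⁆ = 0 := by
  rw [← lie_skew, lie_ofU_left, neg_zero]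

theorem structureConstant_eq {ι κ : Type*} [Fintype ι] [Fintype κ]
    (z : OrthonormalBasis ι ℝ U) (v : OrthonormalBasis κ ℝ V) (p q r : ι ⊕ κ) :
    structureConstant M z v p q r = 0 ∨
      ∃ i j k, structureConstant M z v p q r = ⟪M.J (z k) (v i), v j⟫_ℝ := by
  classical
  unfold structureConstant
  rcases p with p | i
  · left
    rw [basis_inl, lie_ofU_left]
    simp
  rcases q with q | j
  · left
    rw [basis_inl, lie_ofU_right]
    simp
  have h : ⁅basis M z v (Sum.inr i), basis M z v (Sum.inr j)⁆ =
      ∑ k, ⟪M.J (z k) (v i), v j⟫_ℝ • basis M z v (Sum.inl k) := by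
    simp only [basis_inr, basis_inl, lie_ofV_ofV_eq_sum M z]
  rw [h, map_sum]
  rcases r with k | l
  · right
    refine ⟨i, j, k, ?_⟩
    simp [OrthonormalBasis.repr_self, Pi.single_apply]
  · left
    simp [OrthonormalBasis.repr_self]

end HTypeLieAlgebra

theorem theorem1 {U V : Type*}
    [NormedAddCommGroup U] [InnerProductSpace ℝ U] [FiniteDimensional ℝ U]
    [NormedAddCommGroup V] [InnerProductSpace ℝ V] [FiniteDimensional ℝ V]
    (M : OrthogonalMultiplication U V) :
    ∃ (z : OrthonormalBasis (Fin (Module.finrank ℝ U)) ℝ U)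
      (v : OrthonormalBasis (Fin (Module.finrank ℝ V)) ℝ V)
      (A : Fin (Module.finrank ℝ V) → Fin (Module.finrank ℝ V) →
        Fin (Module.finrank ℝ U) → ℤ),
      (∀ i j, ⁅HTypeLieAlgebra.ofV M (v i), HTypeLieAlgebra.ofV M (v j)⁆ =
        ∑ k, (A i j k : ℝ) • HTypeLieAlgebra.ofU M (z k)) ∧
      (∀ i j k, A i j k = 0 ∨ A i j k = 1 ∨ A i j k = -1) ∧
      (∀ p q r, HTypeLieAlgebra.structureConstant M z v p q r = 0 ∨
        HTypeLieAlgebra.structureConstant M z v p q r = 1 ∨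
        HTypeLieAlgebra.structureConstant M z v p q r = -1) := by
  -- Any orthonormal basis of `U` would do; only that of `V` must be adapted.
  let z := stdOrthonormalBasis ℝ U
  obtain ⟨v, hv⟩ :=
    (M.isSignCommuting_closure_range z.orthonormal).exists_orthonormalBasis
  replace hv i j k := hv (M.J (z k)) (Submonoid.subset_closure ⟨k, rfl⟩) i j
  have hA : ∀ i j k, ∃ a : ℤ, (a : ℝ) = ⟪M.J (z k) (v i), v j⟫_ℝ ∧
      (a = 0 ∨ a = 1 ∨ a = -1) := by
    intro i j k
    rcases hv i j k with h | h | h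
    · exact ⟨0, by simp [h], by simp⟩
    · exact ⟨1, by simp [h], by simp⟩
    · exact ⟨-1, by simp [h], by simp⟩
  choose A hA hA' using hA
  refine ⟨z, v, A, fun i j => ?_, hA', fun p q r => ?_⟩
  · simp only [hA, HTypeLieAlgebra.lie_ofV_ofV_eq_sum M z]
  · rcases HTypeLieAlgebra.structureConstant_eq M z v p q r with h | ⟨i, j, k, h⟩
    · exact Or.inl h
    · rw [h]
      exact hv i j k
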